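/- Fix an integer $n\ge 1$. An interval of type $n$ is a pair of integers $x=[a,b]$ with $1\le a\le b\le n$; its length is $b-a$. Let $\mathcal I_n$ be the $\mathbb F_2$-linear category whose objects are the intervals of type $n$, with $\operatorname{Hom}([a,b],[c,d])=\mathbb F_2$ if $a\le c\le b\le d$ and $\{0\}$ otherwise. Write $\alpha_{xy}$ for the non-zero morphism $x\to y$ if there is one. Composition is bilinear and determined by $\alpha_{yz}\circ\alpha_{xy}=\alpha_{xz}$ if $x=[a,b]$, $y=[c,d]$, $z=[e,f]$ satisfy $a\le c\le e\le b\le d\le f$, all other composites being zero. Let $\mathcal A_n$ be the $\mathbb F_2$-linear category whose objects are the finite multisets $\{x_1,\dots,x_r\}$ of intervals of type $n$, whose morphisms $\{x_i\}_i\to\{y_j\}_j$ are the matrices $(\phi_{ij})$ with $\phi_{ij}\in\operatorname{Hom}_{\mathcal I_n}(x_i,y_j)$, and whose composition is matrix multiplication, $(\psi_{jk})\circ(\phi_{ij})=\bigl(\sum_j\psi_{jk}\circ\phi_{ij}\bigr)$. **Lemma.** The category $\mathcal A_n$ (with this additive structure) is abelian. The direct sum of finitely many objects is given by the disjoint union of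 multisets. The full subcategory of indecomposable objects of $\mathcal A_n$ identifies with $\mathcal I_n$: the functor $\mathcal I_n\to\mathcal A_n$, $x\mapsto\{x\}$, is $\mathbb F_2$-linear, fully faithful and injective on objects, and an object of $\mathcal A_n$ is indecomposable if and only if it is of the form $\{x\}$ for an interval $x$. Every object of $\mathcal A_n$ admits a finite composition series, and the composition length of an interval of length $l$ equals $l+1$; that is, $\{x\}$, for $x$ of length $l$, has a composition series of length $l+1$, and each of its composition series has that length. -/

import Mathlib

open CategoryTheory CategoryTheory.Limits

/-- Intervals of type `n`: pairs of integers `[a, b]` with `1 ≤ a ≤ b ≤ n`.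
These are the objects of the category `I_n`. -/
@[ext]
structure IntervalOfType (n : ℕ) where
  /-- the left end point -/
  a : ℤ
  /-- the right end point -/
  b : ℤ
  one_le : 1 ≤ a
  a_le_b : a ≤ b
  le_n : b ≤ n
  deriving DecidableEq

namespace IntervalOfType

variable {n : ℕ}

/-- An interval `[a, b]` has length `l` when `b - a = l`. -/
def HasLength (x : IntervalOfType n) (l : ℕ) : Prop := x.b - x.a = l

/-- The condition `a ≤ c ≤ b ≤ d` for `x = [a, b]` and `y = [c, d]`. -/
def Rel (x y : IntervalOfType n) : Prop := x.a ≤ y.a ∧ y.a ≤ x.b ∧ x.b ≤ y.b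

instance (x y : IntervalOfType n) : Decidable (Rel x y) :=
  inferInstanceAs (Decidable (_ ∧ _ ∧ _))

/-- `Hom(x, y)` is the `𝔽₂`-linear space `𝔽₂` if `a ≤ c ≤ b ≤ d`, and `{0}` otherwise. -/
def homSpace (x y : IntervalOfType n) : Submodule (ZMod 2) (ZMod 2) :=
  if Rel x y then ⊤ else ⊥

lemma rel_refl (x : IntervalOfType n) : Rel x x := ⟨le_rfl, x.a_le_b, le_rfl⟩

lemma mem_homSpace {x y : IntervalOfType n} {r : ZMod 2} :
    r ∈ homSpace x y ↔ (Rel x y ∨ r = 0) := by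
  unfold homSpace
  split_ifs with h <;> simp [h]

/-- Composition of `φ : x ⟶ y` with `ψ : y ⟶ z`. It is bilinear; for non-zero `φ = α_{xy}` and
`ψ = α_{yz}` (so that `x` is related to `y` and `y` to `z`) it is `α_{xz}` when
`a ≤ c ≤ e ≤ b ≤ d ≤ f`, where `x = [a, b]`, `y = [c, d]`, `z = [e, f]`, and `0` otherwise. -/
def comp {x y z : IntervalOfType n} (φ : homSpace x y) (ψ : homSpace y z) : homSpace x z :=
  ⟨if x.a ≤ y.a ∧ y.a ≤ z.a ∧ z.a ≤ x.b ∧ x.b ≤ y.b ∧ y.b ≤ z.b then ψ.1 * φ.1 else 0, by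
    rw [mem_homSpace]
    split_ifs with h
    · exact Or.inl ⟨h.1.trans h.2.1, h.2.2.1, h.2.2.2.1.trans h.2.2.2.2⟩
    · exact Or.inr rfl⟩

lemma comp_val {x y z : IntervalOfType n} (φ : homSpace x y) (ψ : homSpace y z) :
    (comp φ ψ).1 = if z.a ≤ x.b then ψ.1 * φ.1 else 0 := by
  change (if _ then _ else _) = _
  rcases mem_homSpace.1 φ.2 with h1 | h1
  · rcases mem_homSpace.1 ψ.2 with h2 | h2
    · congr 1
      exact propext ⟨fun h => h.2.2.1, fun h => ⟨h1.1, h2.1, h, h1.2.2, h2.2.2⟩⟩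
    · simp [h2]
  · simp [h1]

lemma comp_assoc {x y z w : IntervalOfType n} (φ : homSpace x y) (ψ : homSpace y z)
    (χ : homSpace z w) : comp (comp φ ψ) χ = comp φ (comp ψ χ) := by
  apply Subtype.ext
  rw [comp_val, comp_val, comp_val, comp_val]
  rcases mem_homSpace.1 φ.2 with h1 | h1
  · rcases mem_homSpace.1 χ.2 with h2 | h2
    · have e1 : w.a ≤ x.b → z.a ≤ x.b := fun h => h2.1.trans h
      have e2 : w.a ≤ x.b → w.a ≤ y.b := fun h => h.trans h1.2.2
      split_ifs <;> first | tauto | ring_nf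
    · simp [h2]
  · simp [h1]

/-- The identity of `x` is the non-zero element `α_{xx}` of `Hom(x, x)`. -/
def one (x : IntervalOfType n) : homSpace x x := ⟨1, mem_homSpace.2 (Or.inl (rel_refl x))⟩

lemma one_comp {x y : IntervalOfType n} (φ : homSpace x y) : comp (one x) φ = φ := by
  apply Subtype.ext
  rw [comp_val]
  rcases mem_homSpace.1 φ.2 with h | h
  · simp [h.2.1, one]
  · simp [h]

lemma comp_one {x y : IntervalOfType n} (φ : homSpace x y) : comp φ (one y) = φ := by
  apply Subtype.ext
  rw [comp_val]
  rcases mem_homSpace.1 φ.2 with h | h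
  · simp [h.2.1, one]
  · simp [h]

lemma add_comp {x y z : IntervalOfType n} (φ φ' : homSpace x y) (ψ : homSpace y z) :
    comp (φ + φ') ψ = comp φ ψ + comp φ' ψ := by
  apply Subtype.ext
  rw [Submodule.coe_add, comp_val, comp_val, comp_val, Submodule.coe_add]
  split_ifs <;> ring

lemma comp_add {x y z : IntervalOfType n} (φ : homSpace x y) (ψ ψ' : homSpace y z) :
    comp φ (ψ + ψ') = comp φ ψ + comp φ ψ' := by
  apply Subtype.ext
  rw [Submodule.coe_add, comp_val, comp_val, comp_val, Submodule.coe_add]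
  split_ifs <;> ring

lemma smul_comp {x y z : IntervalOfType n} (r : ZMod 2) (φ : homSpace x y) (ψ : homSpace y z) :
    comp (r • φ) ψ = r • comp φ ψ := by
  apply Subtype.ext
  rw [Submodule.coe_smul, comp_val, comp_val, Submodule.coe_smul, smul_eq_mul, smul_eq_mul]
  split_ifs <;> ring

lemma comp_smul {x y z : IntervalOfType n} (φ : homSpace x y) (r : ZMod 2) (ψ : homSpace y z) :
    comp φ (r • ψ) = r • comp φ ψ := by
  apply Subtype.ext
  rw [Submodule.coe_smul, comp_val, comp_val, Submodule.coe_smul, smul_eq_mul, smul_eq_mul]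
  split_ifs <;> ring

/-- Composition as a biadditive map. -/
def compHom (x y z : IntervalOfType n) : homSpace x y →+ homSpace y z →+ homSpace x z :=
  AddMonoidHom.mk' (fun φ => AddMonoidHom.mk' (fun ψ => comp φ ψ) (comp_add φ))
    (fun φ φ' => AddMonoidHom.ext (add_comp φ φ'))

lemma compHom_apply {x y z : IntervalOfType n} (φ : homSpace x y) (ψ : homSpace y z) :
    compHom x y z φ ψ = comp φ ψ := rfl

/-- The category `I_n` of intervals of type `n`. -/
instance category (n : ℕ) : Category.{0} (IntervalOfType n) where
  Hom x y := homSpace x y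
  id x := one x
  comp φ ψ := comp φ ψ
  id_comp φ := one_comp φ
  comp_id φ := comp_one φ
  assoc φ ψ χ := comp_assoc φ ψ χ

instance preadditive (n : ℕ) : Preadditive (IntervalOfType n) where
  homGroup x y := inferInstanceAs (AddCommGroup (homSpace x y))
  add_comp _ _ _ φ φ' ψ := add_comp φ φ' ψ
  comp_add _ _ _ φ ψ ψ' := comp_add φ ψ ψ'

/-- The category `I_n` is `𝔽₂`-linear. -/
instance linear (n : ℕ) : Linear (ZMod 2) (IntervalOfType n) where
  homModule x y := inferInstanceAs (Module (ZMod 2) (homSpace x y))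
  smul_comp _ _ _ r φ ψ := smul_comp r φ ψ
  comp_smul _ _ _ φ r ψ := comp_smul φ r ψ

end IntervalOfType

/-- Finite multisets of intervals of type `n`: the objects of the category `A_n`. -/
def IntervalMultiset (n : ℕ) : Type := Multiset (IntervalOfType n)

namespace IntervalMultiset

open IntervalOfType

variable {n : ℕ}

/-- Addition of multisets is disjoint union, and `0` is the empty multiset. -/
instance : AddCommMonoid (IntervalMultiset n) :=
  inferInstanceAs (AddCommMonoid (Multiset (IntervalOfType n)))

/-- The multiset `{x}` with the single element `x`. -/
def single (x : IntervalOfType n) : IntervalMultiset n := ({x} : Multiset (IntervalOfType n))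

/-- The index set of a multiset `X = {x_1, …, x_r}`: it has one element for each member of `X`,
counted with multiplicity. -/
def Index (X : IntervalMultiset n) : Type := Multiset.ToType (α := IntervalOfType n) X

instance (X : IntervalMultiset n) : Fintype X.Index :=
  Multiset.fintypeCoe (α := IntervalOfType n) (m := X)

instance (X : IntervalMultiset n) : DecidableEq X.Index :=
  inferInstanceAs (DecidableEq ((x : IntervalOfType n) × Fin (Multiset.count x X)))

/-- The member `x_i` of the multiset `X` with index `i`. -/
def entry (X : IntervalMultiset n) (i : X.Index) : IntervalOfType n := i.1

lemma entry_single (x : IntervalOfType n) (i : (single x).Index) : (single x).entry i = x := by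
  have h : 0 < Multiset.count i.1 ({x} : Multiset (IntervalOfType n)) :=
    lt_of_le_of_lt (Nat.zero_le _) i.2.2
  exact Multiset.mem_singleton.1 (Multiset.count_pos.1 h)

/-- Morphisms `⊕ x_i ⟶ ⊕ y_j` are matrices of morphisms `x_i ⟶ y_j`. -/
abbrev Mor (X Y : IntervalMultiset n) : Type :=
  (i : X.Index) → (j : Y.Index) → homSpace (X.entry i) (Y.entry j)

/-- Composition is matrix multiplication. -/
def comp {X Y Z : IntervalMultiset n} (φ : Mor X Y) (ψ : Mor Y Z) : Mor X Z :=
  fun i k => ∑ j, IntervalOfType.comp (φ i j) (ψ j k)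

/-- The identity matrix. -/
def one (X : IntervalMultiset n) : Mor X X :=
  fun i j => ⟨if i = j then 1 else 0, by
    split_ifs with h
    · subst h; exact (IntervalOfType.one (X.entry i)).2
    · exact Submodule.zero_mem _⟩

lemma one_self (X : IntervalMultiset n) (i : X.Index) :
    one X i i = IntervalOfType.one (X.entry i) := Subtype.ext (if_pos rfl)

lemma one_ne (X : IntervalMultiset n) {i j : X.Index} (h : i ≠ j) : one X i j = 0 :=
  Subtype.ext (if_neg h)

lemma sum_comp {ι : Type} (s : Finset ι) {x y z : IntervalOfType n} (φ : ι → homSpace x y)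
    (ψ : homSpace y z) :
    IntervalOfType.comp (∑ j ∈ s, φ j) ψ = ∑ j ∈ s, IntervalOfType.comp (φ j) ψ := by
  simp only [← compHom_apply, map_sum, AddMonoidHom.finsetSum_apply]

lemma comp_sum {ι : Type} (s : Finset ι) {x y z : IntervalOfType n} (φ : homSpace x y)
    (ψ : ι → homSpace y z) :
    IntervalOfType.comp φ (∑ j ∈ s, ψ j) = ∑ j ∈ s, IntervalOfType.comp φ (ψ j) := by
  simp only [← compHom_apply, map_sum]

lemma one_comp {X Y : IntervalMultiset n} (φ : Mor X Y) : comp (one X) φ = φ := by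
  funext i k
  change ∑ j, _ = _
  rw [Finset.sum_eq_single i]
  · rw [one_self, IntervalOfType.one_comp]
  · intro j _ hj
    rw [one_ne X (Ne.symm hj), ← compHom_apply, map_zero, AddMonoidHom.zero_apply]
  · simp

lemma comp_one {X Y : IntervalMultiset n} (φ : Mor X Y) : comp φ (one Y) = φ := by
  funext i k
  change ∑ j, _ = _
  rw [Finset.sum_eq_single k]
  · rw [one_self, IntervalOfType.comp_one]
  · intro j _ hj
    rw [one_ne Y hj, ← compHom_apply, map_zero]
  · simp

/-- The category `A_n` of multisets of intervals of type `n`. -/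
instance category (n : ℕ) : Category.{0} (IntervalMultiset n) where
  Hom X Y := Mor X Y
  id X := one X
  comp φ ψ := comp φ ψ
  id_comp φ := one_comp φ
  comp_id φ := comp_one φ
  assoc φ ψ χ := by
    funext i l
    change ∑ k, IntervalOfType.comp (∑ j, _) _ = ∑ j, IntervalOfType.comp _ (∑ k, _)
    simp only [sum_comp, comp_sum, comp_assoc]
    exact Finset.sum_comm

instance preadditive (n : ℕ) : Preadditive (IntervalMultiset n) where
  homGroup X Y := inferInstanceAs (AddCommGroup (Mor X Y))
  add_comp _ _ _ φ φ' ψ := by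
    funext i k
    exact (Finset.sum_congr rfl fun j _ => IntervalOfType.add_comp (φ i j) (φ' i j) (ψ j k)).trans
      Finset.sum_add_distrib
  comp_add _ _ _ φ ψ ψ' := by
    funext i k
    exact (Finset.sum_congr rfl fun j _ => IntervalOfType.comp_add (φ i j) (ψ j k) (ψ' j k)).trans
      Finset.sum_add_distrib

/-- The category `A_n` is `𝔽₂`-linear. -/
instance linear (n : ℕ) : Linear (ZMod 2) (IntervalMultiset n) where
  homModule X Y := inferInstanceAs (Module (ZMod 2) (Mor X Y))
  smul_comp _ _ _ r φ ψ := by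
    funext i k
    exact (Finset.sum_congr rfl fun j _ => IntervalOfType.smul_comp r (φ i j) (ψ j k)).trans
      Finset.smul_sum.symm
  comp_smul _ _ _ φ r ψ := by
    funext i k
    exact (Finset.sum_congr rfl fun j _ => IntervalOfType.comp_smul (φ i j) r (ψ j k)).trans
      Finset.smul_sum.symm

instance (x : IntervalOfType n) : Unique (single x).Index where
  default := ⟨x, ⟨0, Multiset.count_pos.2 (Multiset.mem_singleton_self x)⟩⟩
  uniq i := by
    obtain ⟨y, k, hk⟩ := i
    obtain rfl : y = x := entry_single x ⟨y, k, hk⟩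
    have : Multiset.count y (single y) = 1 := Multiset.count_singleton_self y
    have hk0 : k = 0 := by omega
    subst hk0
    rfl

/-- The inclusion functor from `I_n` to `A_n`, which sends `x` to `{x}` and `φ : x ⟶ y` to the
one-by-one matrix with entry `φ`. -/
def incl (n : ℕ) : IntervalOfType n ⥤ IntervalMultiset n where
  obj x := single x
  map {x y} φ := fun i j =>
    ⟨φ.1, by rw [entry_single, entry_single]; exact φ.2⟩
  map_id x := by
    funext i j
    obtain rfl : i = default := Subsingleton.elim _ _
    obtain rfl : j = default := Subsingleton.elim _ _
    change _ = one (single x) default default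
    rw [one_self]
    rfl
  map_comp {x y z} φ ψ := by
    funext i k
    obtain rfl : i = default := Subsingleton.elim _ _
    obtain rfl : k = default := Subsingleton.elim _ _
    change _ = ∑ j : (single y).Index, _
    rw [Fintype.sum_unique]
    rfl

end IntervalMultiset

/-- A composition series of length `m` of an object `X`: a chain of subobjects
`0 = X_0 ≤ X_1 ≤ ⋯ ≤ X_m = X` such that each inclusion `X_i ⟶ X_{i+1}` has a cokernel
`X_{i+1} / X_i` which is a simple object. -/
structure ObjectCompositionSeries {C : Type*} [Category C] [HasZeroMorphisms C] (X : C)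
    (m : ℕ) where
  /-- the members of the chain -/
  sub : Fin (m + 1) → Subobject X
  isZero_first : IsZero (sub 0 : C)
  last_eq_top : sub (Fin.last m) = ⊤
  le (i : Fin m) : sub i.castSucc ≤ sub i.succ
  /-- the composition factors -/
  factor : Fin m → C
  /-- the projections onto the composition factors -/
  proj (i : Fin m) : (sub i.succ : C) ⟶ factor i
  comp_proj (i : Fin m) : Subobject.ofLE _ _ (le i) ≫ proj i = 0
  isCokernel (i : Fin m) : Nonempty (IsColimit (CokernelCofork.ofπ (proj i) (comp_proj i)))
  simple (i : Fin m) : Simple (factor i)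

namespace IntervalMultiset

open IntervalOfType

variable {n : ℕ}

lemma hom_ext_val {X Y : IntervalMultiset n} {f g : X ⟶ Y} (h : ∀ i j, (f i j).1 = (g i j).1) :
    f = g :=
  funext fun i => funext fun j => Subtype.ext (h i j)

lemma sum_val {ι : Type*} (s : Finset ι) {X Y : IntervalMultiset n} (f : ι → (X ⟶ Y))
    (i : X.Index) (j : Y.Index) : ((∑ k ∈ s, f k) i j).1 = ∑ k ∈ s, (f k i j).1 := by
  induction s using Finset.cons_induction with
  | empty => rfl
  | cons a s ha ih => rw [Finset.sum_cons, Finset.sum_cons, ← ih]; rfl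

lemma id_val (X : IntervalMultiset n) (i j : X.Index) :
    ((𝟙 X : X ⟶ X) i j).1 = if i = j then 1 else 0 := rfl

lemma comp_val {X Y Z : IntervalMultiset n} (f : X ⟶ Y) (g : Y ⟶ Z) (i : X.Index) (k : Z.Index) :
    ((f ≫ g) i k).1 =
      ∑ j, if (Z.entry k).a ≤ (X.entry i).b then (g j k).1 * (f i j).1 else 0 := by
  change (∑ j, IntervalOfType.comp (f i j) (g j k) : homSpace _ _).1 = _
  rw [Submodule.coe_sum]
  exact Finset.sum_congr rfl fun j _ => IntervalOfType.comp_val _ _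

lemma val_eq_zero {X Y : IntervalMultiset n} (f : X ⟶ Y) {i : X.Index} {j : Y.Index}
    (h : ¬ Rel (X.entry i) (Y.entry j)) : (f i j).1 = 0 :=
  (mem_homSpace.1 (f i j).2).resolve_left h

/-- The `0`-`1`-matrix of a relation between the indices of two multisets which relates only equal
entries. -/
def ofRel {X Y : IntervalMultiset n} (R : X.Index → Y.Index → Prop) [∀ i j, Decidable (R i j)]
    (hR : ∀ i j, R i j → X.entry i = Y.entry j) : X ⟶ Y :=
  fun i j => ⟨if R i j then 1 else 0, by
    rw [mem_homSpace]
    split_ifs with h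
    · rw [hR i j h]; exact Or.inl (rel_refl _)
    · exact Or.inr rfl⟩

lemma ofRel_comp_val {X Y Z : IntervalMultiset n} (R : X.Index → Y.Index → Prop)
    [∀ i j, Decidable (R i j)] (hR : ∀ i j, R i j → X.entry i = Y.entry j) (f : Y ⟶ Z)
    (i : X.Index) (k : Z.Index) :
    ((ofRel R hR ≫ f) i k).1 = ∑ j, if R i j then (f j k).1 else 0 := by
  rw [comp_val]
  refine Finset.sum_congr rfl fun j _ => ?_
  change (if _ then (f j k).1 * (if R i j then 1 else 0) else 0) = _
  by_cases h : R i j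
  · rw [if_pos h, if_pos h, mul_one, hR i j h]
    split_ifs with h'
    · rfl
    · exact (val_eq_zero f fun h'' => h' h''.2.1).symm
  · simp [h]

section Biproduct

variable {ι : Type} (X : ι → IntervalMultiset n) (Z : IntervalMultiset n)
  (e : Z.Index ≃ Σ i, (X i).Index)

lemma entry_eq_of_equiv (he : ∀ k, Z.entry k = (X (e k).1).entry (e k).2) (i : ι) (p : (X i).Index)
    (k : Z.Index) (h : e k = ⟨i, p⟩) : Z.entry k = (X i).entry p := by
  rw [he k, h]

variable [DecidableEq ι]

/-- A multiset whose members are in bijection with those of a family of multisets, as a bicone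
over this family. -/
def biconeOfEquiv (he : ∀ k, Z.entry k = (X (e k).1).entry (e k).2) : Bicone X where
  pt := Z
  π i := ofRel (fun k p => e k = ⟨i, p⟩) fun k p => entry_eq_of_equiv X Z e he i p k
  ι i := ofRel (fun p k => e k = ⟨i, p⟩) fun p k h => (entry_eq_of_equiv X Z e he i p k h).symm
  ι_π i j := by
    refine hom_ext_val fun p q => ?_
    rw [ofRel_comp_val]
    change (∑ k, if e k = ⟨i, p⟩ then (if e k = ⟨j, q⟩ then 1 else 0) else (0 : ZMod 2)) = _
    rw [Finset.sum_eq_single (e.symm ⟨i, p⟩)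
      (fun k _ hk => if_neg fun h => hk (e.eq_symm_apply.2 h)) (by simp),
      e.apply_symm_apply, if_pos rfl]
    by_cases h : i = j
    · subst h
      rw [dif_pos rfl, eqToHom_refl, id_val]
      simp
    · rw [dif_neg h, if_neg fun h' => h (Sigma.mk.inj_iff.1 h').1]
      rfl

/-- The bicone `biconeOfEquiv` is a biproduct. -/
noncomputable def biconeOfEquivIsBilimit [Fintype ι]
    (he : ∀ k, Z.entry k = (X (e k).1).entry (e k).2) : (biconeOfEquiv X Z e he).IsBilimit :=
  isBilimitOfTotal _ <| by
    refine hom_ext_val fun (k l : Z.Index) => ?_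
    refine (sum_val (X := Z) (Y := Z) _ _ k l).trans ?_
    have h (i : ι) : (((biconeOfEquiv X Z e he).π i ≫ (biconeOfEquiv X Z e he).ι i) k l).1 =
        if i = (e k).1 ∧ e k = e l then 1 else 0 := by
      refine (ofRel_comp_val _ (fun k p => entry_eq_of_equiv X Z e he i p k) _ k l).trans ?_
      change (∑ p, if e k = ⟨i, p⟩ then (if e l = ⟨i, p⟩ then 1 else 0) else (0 : ZMod 2)) = _
      split_ifs with h
      · obtain ⟨rfl, h⟩ := h
        rw [← h, Finset.sum_eq_single (e k).2 (fun p _ hp => if_neg fun h' => hp ?_) (by simp),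
          if_pos rfl, if_pos rfl]
        exact (eq_of_heq (Sigma.ext_iff.1 h').2).symm
      · refine Finset.sum_eq_zero fun p _ => ?_
        split_ifs with h1 h2
        · exact absurd ⟨by rw [h1], h1.trans h2.symm⟩ h
        · rfl
        · rfl
    simp only [h]
    rw [Finset.sum_eq_single (e k).1 (fun i _ hi => if_neg fun h => hi h.1) (by simp)]
    refine Eq.trans ?_ (id_val Z k l).symm
    simp

end Biproduct

lemma count_sum {ι : Type} [Fintype ι] (X : ι → IntervalMultiset n) (x : IntervalOfType n) :
    Multiset.count x (∑ i, X i : IntervalMultiset n) =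
      ∑ i, Multiset.count x (X i : Multiset (IntervalOfType n)) :=
  map_sum (Multiset.countAddMonoidHom x) X Finset.univ

/-- The members of a sum of multisets are those of the summands. -/
noncomputable def sumEquiv {ι : Type} [Fintype ι] (X : ι → IntervalMultiset n) :
    (∑ i, X i).Index ≃ Σ i, (X i).Index :=
  (Equiv.sigmaCongrRight fun x => Fintype.equivOfCardEq (β := Σ i, Fin (Multiset.count x (X i)))
    (by simp [count_sum])).trans
    { toFun := fun p => ⟨p.2.1, p.1, p.2.2⟩
      invFun := fun p => ⟨p.2.1, p.1, p.2.2⟩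
      left_inv := fun _ => rfl
      right_inv := fun _ => rfl }

theorem exists_isBilimit_sum {ι : Type} [Fintype ι] (X : ι → IntervalMultiset n) :
    ∃ B : Bicone X, B.pt = ∑ i, X i ∧ Nonempty B.IsBilimit := by
  classical
  exact ⟨biconeOfEquiv X _ (sumEquiv X) fun _ => rfl, rfl, ⟨biconeOfEquivIsBilimit _ _ _ _⟩⟩

instance : HasFiniteBiproducts (IntervalMultiset n) where
  out _ := ⟨fun X => (exists_isBilimit_sum X).elim fun B h => ⟨⟨⟨B, h.2.some⟩⟩⟩⟩

instance : HasBinaryBiproducts (IntervalMultiset n) := hasBinaryBiproducts_of_finite_biproducts _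

/-- A multiset as a bicone over its members. -/
def singlesBicone (X : IntervalMultiset n) : Bicone fun i : X.Index => (incl n).obj (X.entry i) :=
  biconeOfEquiv (fun i => single (X.entry i)) X
    (Equiv.sigmaUnique _ fun i => (single (X.entry i)).Index).symm fun _ => rfl

/-- A multiset is the biproduct of its members. -/
noncomputable def singlesBiconeIsBilimit (X : IntervalMultiset n) : X.singlesBicone.IsBilimit :=
  biconeOfEquivIsBilimit _ _ _ _

theorem incl_obj_injective : Function.Injective (incl n).obj :=
  fun _ _ h => Multiset.singleton_inj.1 h

instance (x : IntervalOfType n) : Unique ((incl n).obj x).Index :=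
  inferInstanceAs (Unique (single x).Index)

/-- The single entry of a one-by-one matrix. -/
def coef {x y : IntervalOfType n} (f : (incl n).obj x ⟶ (incl n).obj y) : ZMod 2 :=
  (f default default).1

lemma val_eq_coef {x y : IntervalOfType n} (f : (incl n).obj x ⟶ (incl n).obj y)
    (i : ((incl n).obj x).Index) (j : ((incl n).obj y).Index) : (f i j).1 = coef f := by
  obtain rfl : i = default := Subsingleton.elim _ _
  obtain rfl : j = default := Subsingleton.elim _ _
  rfl

lemma incl_hom_ext {x y : IntervalOfType n} {f g : (incl n).obj x ⟶ (incl n).obj y}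
    (h : coef f = coef g) : f = g :=
  hom_ext_val fun i j => by rw [val_eq_coef, h, val_eq_coef]

instance : (incl n).Full where
  map_surjective {x y} f := ⟨(f default default : homSpace x y), incl_hom_ext rfl⟩

instance : (incl n).Faithful where
  map_injective h := Subtype.ext (congrArg coef h)

instance : (incl n).Additive where
  map_add := rfl

instance : (incl n).Linear (ZMod 2) where
  map_smul _ _ := rfl

lemma zmod_two_eq_one {r : ZMod 2} (h : r ≠ 0) : r = 1 := by
  revert r; decide

lemma coef_comp {x y z : IntervalOfType n} (f : (incl n).obj x ⟶ (incl n).obj y)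
    (g : (incl n).obj y ⟶ (incl n).obj z) :
    coef (f ≫ g) = if z.a ≤ x.b then coef g * coef f else 0 :=
  (comp_val f g default default).trans (Fintype.sum_unique _)

lemma coef_eq_one_of_ne_zero {x y : IntervalOfType n} {f : (incl n).obj x ⟶ (incl n).obj y}
    (h : f ≠ 0) : coef f = 1 :=
  zmod_two_eq_one fun h' => h (incl_hom_ext h')

lemma eq_id_of_ne_zero {x : IntervalOfType n} {f : (incl n).obj x ⟶ (incl n).obj x} (h : f ≠ 0) :
    f = 𝟙 _ :=
  incl_hom_ext ((coef_eq_one_of_ne_zero h).trans (if_pos rfl).symm)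

/-- The non-zero morphism between two related intervals. -/
def α {x y : IntervalOfType n} (h : Rel x y) : (incl n).obj x ⟶ (incl n).obj y :=
  (incl n).map (⟨1, mem_homSpace.2 (Or.inl h)⟩ : homSpace x y)

lemma coef_α {x y : IntervalOfType n} (h : Rel x y) : coef (α h) = 1 := rfl

lemma α_ne_zero {x y : IntervalOfType n} (h : Rel x y) : α h ≠ 0 := fun h' =>
  one_ne_zero (α := ZMod 2) (congrArg coef h')

lemma eq_zero_of_not_rel {x y : IntervalOfType n} (h : ¬ Rel x y)
    (f : (incl n).obj x ⟶ (incl n).obj y) : f = 0 :=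
  incl_hom_ext (val_eq_zero f h)

lemma isZero_zero : IsZero (0 : IntervalMultiset n) := by
  refine (IsZero.iff_id_eq_zero _).2 (hom_ext_val fun i => ?_)
  exact absurd i.2.2 (by
    have := Multiset.count_zero i.1
    change ¬ _ < Multiset.count i.1 (0 : Multiset (IntervalOfType n))
    omega)

lemma exists_eq_single_add {X : IntervalMultiset n} (h : X ≠ 0) :
    ∃ (x : IntervalOfType n) (Y : IntervalMultiset n), X = single x + Y := by
  obtain ⟨x, hx⟩ := Multiset.exists_mem_of_ne_zero h
  obtain ⟨Y, hY⟩ := Multiset.exists_cons_of_mem hx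
  exact ⟨x, Y, hY.trans (Multiset.singleton_add x Y).symm⟩

lemma not_isZero_incl (x : IntervalOfType n) : ¬ IsZero ((incl n).obj x) := fun h =>
  α_ne_zero (rel_refl x) (h.eq_of_src _ _)

lemma exists_retract {X : IntervalMultiset n} (h : X ≠ 0) :
    ∃ (x : IntervalOfType n), Nonempty (Retract ((incl n).obj x) X) := by
  obtain ⟨x, hx⟩ := Multiset.exists_mem_of_ne_zero h
  let i : X.Index := ⟨x, ⟨0, Multiset.count_pos.2 hx⟩⟩
  exact ⟨x, ⟨⟨X.singlesBicone.ι i, X.singlesBicone.π i, bicone_ι_π_self _ i⟩⟩⟩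

lemma isZero_iff (X : IntervalMultiset n) : IsZero X ↔ X = 0 := by
  refine ⟨fun h => ?_, fun h => h ▸ isZero_zero⟩
  by_contra h'
  obtain ⟨x, ⟨r⟩⟩ := exists_retract h'
  exact not_isZero_incl x ((IsZero.iff_id_eq_zero _).2 (by rw [← r.retract,
    h.eq_of_src r.r 0, comp_zero]))

/-- The sum of two multisets is their direct sum. -/
lemma nonempty_add_iso_biprod (X Y : IntervalMultiset n) : Nonempty (X + Y ≅ X ⊞ Y) := by
  obtain ⟨B, hB, ⟨h⟩⟩ := exists_isBilimit_sum (pairFunction X Y)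
  have e : B.pt = X + Y := by
    rw [hB, Fintype.sum_eq_add WalkingPair.left WalkingPair.right (by simp)
      (by rintro (_ | _) <;> simp)]
    rfl
  refine ⟨eqToIso e.symm ≪≫ biprod.uniqueUpToIso _ _ (b := B.toBinaryBicone) ?_⟩
  exact (Bicone.toBinaryBiconeIsBilimit B).symm h

theorem indecomposable_iff (X : IntervalMultiset n) :
    Indecomposable X ↔ ∃ x : IntervalOfType n, X = (incl n).obj x := by
  constructor
  · rintro ⟨h0, h⟩
    obtain ⟨x, Y, rfl⟩ := exists_eq_single_add (mt (isZero_iff X).2 h0)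
    obtain ⟨e⟩ := nonempty_add_iso_biprod (single x) Y
    have := (isZero_iff _).1 ((h _ _ e).resolve_left (not_isZero_incl x))
    exact ⟨x, by rw [this, add_zero]; rfl⟩
  · rintro ⟨x, rfl⟩
    refine ⟨not_isZero_incl x, fun Y Z e => ?_⟩
    by_cases h : e.hom ≫ biprod.fst = 0
    · left
      rw [IsZero.iff_id_eq_zero, ← biprod.inl_fst (X := Y) (Y := Z), ← Category.id_comp biprod.fst,
        ← e.inv_hom_id, Category.assoc, h, comp_zero, comp_zero]
    · right
      have h1 : (e.hom ≫ biprod.fst) ≫ biprod.inl ≫ e.inv = 𝟙 _ := by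
        refine eq_id_of_ne_zero fun h' => h ?_
        have := congrArg (· ≫ e.hom ≫ biprod.fst) h'
        simpa using this
      have h2 : biprod.inr ≫ e.inv = (0 : Z ⟶ _) := by
        rw [← Category.comp_id e.inv, ← h1]
        simp
      rw [IsZero.iff_id_eq_zero, ← biprod.inr_snd (X := Y) (Y := Z), ← Category.id_comp biprod.snd,
        ← e.inv_hom_id, Category.assoc, reassoc_of% h2, zero_comp]

end IntervalMultiset

/-- An additive functor is faithful if it is so on the members of decompositions of all objects. -/
theorem CategoryTheory.Functor.faithful_of_isBilimit {C D : Type*} [Category C] [Category D]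
    [Preadditive C] {K : Type*} (F : C ⥤ D) (G : K → C)
    (B : ∀ X : C, ∃ (J : Type) (_ : Fintype J) (p : J → K) (b : Limits.Bicone fun j => G (p j)),
      b.pt = X ∧ Nonempty b.IsBilimit)
    (hF : ∀ (x y : K) (f g : G x ⟶ G y), F.map f = F.map g → f = g) : F.Faithful where
  map_injective {X Y} f g h := by
    obtain ⟨J, _, p, b, rfl, ⟨hb⟩⟩ := B X
    obtain ⟨J', _, p', b', rfl, ⟨hb'⟩⟩ := B Y
    refine hb.isColimit.hom_ext fun ⟨i⟩ => hb'.isLimit.hom_ext fun ⟨j⟩ => hF _ _ _ _ ?_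
    change F.map ((b.ι i ≫ f) ≫ b'.π j) = F.map ((b.ι i ≫ g) ≫ b'.π j)
    simp only [Functor.map_comp, h]

/-- An additive functor is full if it is so on the members of decompositions of all objects. -/
theorem CategoryTheory.Functor.full_of_isBilimit {C D : Type*} [Category C] [Category D]
    [Preadditive C] [Preadditive D] {K : Type*} (F : C ⥤ D) [F.Additive] (G : K → C)
    (B : ∀ X : C, ∃ (J : Type) (_ : Fintype J) (p : J → K) (b : Limits.Bicone fun j => G (p j)),
      b.pt = X ∧ Nonempty b.IsBilimit)
    (hF : ∀ (x y : K) (η : F.obj (G x) ⟶ F.obj (G y)), ∃ f, F.map f = η) : F.Full where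
  map_surjective {X Y} η := by
    classical
    obtain ⟨J, _, p, b, rfl, ⟨hb⟩⟩ := B X
    obtain ⟨J', _, p', b', rfl, ⟨hb'⟩⟩ := B Y
    choose f hf using fun i j => hF _ _ (F.map (b.ι i) ≫ η ≫ F.map (b'.π j))
    refine ⟨∑ i, ∑ j, b.π i ≫ f i j ≫ b'.ι j, ?_⟩
    have h1 := IsBilimit.total hb
    have h2 := IsBilimit.total hb'
    calc _ = ∑ i, ∑ j, F.map (b.π i ≫ b.ι i) ≫ η ≫ F.map (b'.π j ≫ b'.ι j) := by
          simp only [F.map_sum, F.map_comp, hf, Category.assoc]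
      _ = _ := by
          simp only [← Preadditive.comp_sum, ← Preadditive.sum_comp, ← F.map_sum, h1, h2,
            F.map_id, Category.id_comp, Category.comp_id]

/-- The category of finite-dimensional representations over `𝔽₂` of the poset `Fin n`, with arrows
pointing downwards. -/
abbrev LinRep (n : ℕ) : Type 1 := (Fin n)ᵒᵖ ⥤ FGModuleCat.{0} (ZMod 2)

namespace LinRep

variable {n : ℕ}

/-- The space of a representation at a vertex. -/
abbrev space (V : LinRep n) (i : Fin n) : Type := V.obj (Opposite.op i)

/-- The transition maps of a representation. -/
def res (V : LinRep n) {i j : Fin n} (h : i ≤ j) : V.space j →ₗ[ZMod 2] V.space i :=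
  (V.map (homOfLE h).op).hom.hom

lemma res_refl (V : LinRep n) {i : Fin n} (v : V.space i) : V.res (le_refl i) v = v :=
  congrArg (fun f : V.obj _ ⟶ V.obj _ => f.hom.hom v) (V.map_id (Opposite.op i))

lemma res_res (V : LinRep n) {i j k : Fin n} (h : i ≤ j) (h' : j ≤ k) (v : V.space k) :
    V.res h (V.res h' v) = V.res (h.trans h') v :=
  congrArg (fun f : V.obj _ ⟶ V.obj _ => f.hom.hom v)
    (V.map_comp (homOfLE h').op (homOfLE h).op).symm

/-- The linear maps which make up a morphism of representations. -/
def ev {V W : LinRep n} (η : V ⟶ W) (i : Fin n) : V.space i →ₗ[ZMod 2] W.space i :=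
  (η.app (Opposite.op i)).hom.hom

lemma ev_res {V W : LinRep n} (η : V ⟶ W) {i j : Fin n} (h : i ≤ j) (v : V.space j) :
    ev η i (V.res h v) = W.res h (ev η j v) :=
  congrArg (fun f : V.obj _ ⟶ W.obj _ => f.hom.hom v) (η.naturality (homOfLE h).op)

lemma hom_ext {V W : LinRep n} {η θ : V ⟶ W} (h : ∀ i v, ev η i v = ev θ i v) : η = θ := by
  ext i : 2
  exact FGModuleCat.hom_ext (LinearMap.ext (h i.unop))

/-- A morphism of representations from a compatible family of linear maps. -/
def homMk {V W : LinRep n} (f : ∀ i, V.space i →ₗ[ZMod 2] W.space i)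
    (hf : ∀ i j (h : i ≤ j) v, f i (V.res h v) = W.res h (f j v)) : V ⟶ W where
  app i := ⟨ModuleCat.ofHom (f i.unop)⟩
  naturality i j u := by
    refine FGModuleCat.hom_ext (LinearMap.ext fun v => ?_)
    exact hf j.unop i.unop (leOfHom u.unop) v

end LinRep

namespace IntervalMultiset

open IntervalOfType

variable {n : ℕ}

/-- The interval `[1, i + 1]`, which represents the value at the vertex `i`. -/
def initial (i : Fin n) : IntervalOfType n where
  a := 1
  b := i + 1
  one_le := le_rfl
  a_le_b := by omega
  le_n := by omega

lemma initial_rel_initial {i j : Fin n} (h : i ≤ j) : Rel (initial i) (initial j) :=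
  ⟨le_rfl, (initial i).a_le_b, by simpa [initial] using h⟩

lemma rel_initial_iff {i : Fin n} {x : IntervalOfType n} :
    Rel (initial i) x ↔ x.a ≤ i + 1 ∧ i + 1 ≤ x.b :=
  ⟨fun h => h.2, fun h => ⟨x.one_le, h⟩⟩

instance (X Y : IntervalMultiset n) : Module.Finite (ZMod 2) (X ⟶ Y) :=
  inferInstanceAs (Module.Finite (ZMod 2) (Mor X Y))

/-- The functor from intervals to representations given by the morphisms from the intervals
`[1, i + 1]`. -/
def toRep (n : ℕ) : IntervalMultiset n ⥤ LinRep n where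
  obj X :=
    { obj i := FGModuleCat.of (ZMod 2) ((incl n).obj (initial i.unop) ⟶ X)
      map {i j} u := FGModuleCat.ofHom (Linear.leftComp (ZMod 2) X
        (α (initial_rel_initial (leOfHom u.unop))))
      map_id i := by
        refine FGModuleCat.hom_ext (LinearMap.ext fun f => ?_)
        exact (congrArg (· ≫ f) (eq_id_of_ne_zero (α_ne_zero _))).trans (Category.id_comp f)
      map_comp {i j k} u v := by
        refine FGModuleCat.hom_ext (LinearMap.ext fun f => ?_)
        refine Eq.trans ?_ (Category.assoc _ _ _)
        refine congrArg (· ≫ f) (incl_hom_ext ?_)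
        rw [coef_comp, if_pos (show (initial i.unop).a ≤ (initial k.unop).b from
          (initial k.unop).a_le_b)]
        rfl }
  map f :=
    { app i := FGModuleCat.ofHom (Linear.rightComp (ZMod 2) _ f)
      naturality i j u := by
        refine FGModuleCat.hom_ext (LinearMap.ext fun v => ?_)
        exact Category.assoc _ v f }
  map_id X := LinRep.hom_ext fun i v => Category.comp_id (Y := X) v
  map_comp f g := LinRep.hom_ext fun i v => (Category.assoc v f g).symm

instance : (toRep n).Additive where
  map_add {X Y f g} := LinRep.hom_ext fun _ v => Preadditive.comp_add _ X Y v f g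

lemma toRep_ev {X Y : IntervalMultiset n} (f : X ⟶ Y) {i : Fin n}
    (g : (incl n).obj (initial i) ⟶ X) : LinRep.ev ((toRep n).map f) i g = g ≫ f := rfl

/-- The vertex at the right end of an interval. -/
def last (x : IntervalOfType n) : Fin n :=
  ⟨(x.b - 1).toNat, by have := x.one_le; have := x.a_le_b; have := x.le_n; omega⟩

lemma last_add_one (x : IntervalOfType n) : ((last x : ℕ) : ℤ) + 1 = x.b := by
  have := x.one_le; have := x.a_le_b; simp only [last]; omega

lemma rel_initial_last (x : IntervalOfType n) : Rel (initial (last x)) x :=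
  rel_initial_iff.2 (by rw [last_add_one]; exact ⟨x.a_le_b, le_rfl⟩)

/-- Every morphism from `[1, i + 1]` to `[a, b]` factors through `[1, b]`. -/
lemma exists_eq_comp_α {i : Fin n} {x : IntervalOfType n}
    {f : (incl n).obj (initial i) ⟶ (incl n).obj x} (hf : f ≠ 0) :
    ∃ h : i ≤ last x, f = α (initial_rel_initial h) ≫ α (rel_initial_last x) := by
  have h : Rel (initial i) x := by
    by_contra h
    exact hf (eq_zero_of_not_rel h f)
  have h' : i ≤ last x := by
    have := (rel_initial_iff.1 h).2
    rw [← last_add_one] at this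
    rw [Fin.le_def]
    omega
  refine ⟨h', incl_hom_ext ?_⟩
  rw [coef_eq_one_of_ne_zero hf, coef_comp, if_pos h.2.1]
  rfl

lemma coef_α_comp {x y z : IntervalOfType n} (h : Rel x y) (hb : x.b = y.b)
    (f : (incl n).obj y ⟶ (incl n).obj z) : coef (α h ≫ f) = coef f := by
  rw [coef_comp, coef_α, mul_one]
  split_ifs with h'
  · rfl
  · rw [eq_zero_of_not_rel (fun h'' => h' (hb ▸ h''.2.1)) f]
    rfl

lemma toRep_map_incl_injective (x y : IntervalOfType n) (f g : (incl n).obj x ⟶ (incl n).obj y)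
    (h : (toRep n).map f = (toRep n).map g) : f = g := by
  have h' : α (rel_initial_last x) ≫ f = α (rel_initial_last x) ≫ g :=
    congrArg (fun η => LinRep.ev η (last x) (α (rel_initial_last x))) h
  refine incl_hom_ext ?_
  rw [← coef_α_comp (rel_initial_last x) (last_add_one x), h',
    coef_α_comp (rel_initial_last x) (last_add_one x)]

lemma toRep_map_incl_surjective (x y : IntervalOfType n)
    (η : (toRep n).obj ((incl n).obj x) ⟶ (toRep n).obj ((incl n).obj y)) :
    ∃ f, (toRep n).map f = η := by
  let β : (incl n).obj (initial (last x)) ⟶ (incl n).obj y :=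
    LinRep.ev η (last x) (α (rel_initial_last x))
  have hη {i : Fin n} (h : i ≤ last x) :
      LinRep.ev η i (α (initial_rel_initial h) ≫ α (rel_initial_last x)) =
        α (initial_rel_initial h) ≫ β :=
    LinRep.ev_res η h (α (rel_initial_last x))
  obtain ⟨f, hf⟩ : ∃ f : (incl n).obj x ⟶ (incl n).obj y, α (rel_initial_last x) ≫ f = β := by
    by_cases hβ : β = 0
    · exact ⟨0, by rw [hβ, comp_zero]⟩
    have h1 : Rel (initial (last x)) y := by
      by_contra h
      exact hβ (eq_zero_of_not_rel h β)
    rw [rel_initial_iff, last_add_one] at h1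
    have h2 : x.a ≤ y.a := by
      by_contra! h2
      have := y.one_le
      have := x.a_le_b
      have := last_add_one x
      let i : Fin n := ⟨(x.a - 2).toNat, by have := x.le_n; omega⟩
      have hi : ((i : ℕ) : ℤ) + 1 = x.a - 1 := by simp only [i]; omega
      have hle : i ≤ last x := by rw [Fin.le_def]; omega
      have h3 : α (initial_rel_initial hle) ≫ α (rel_initial_last x) = 0 :=
        eq_zero_of_not_rel (fun h => by have := h.2.1; simp only [initial] at this; omega) _
      have h4 := hη hle
      rw [h3] at h4
      have h5 := congrArg coef h4
      rw [coef_comp, if_pos (by simp only [initial]; omega), coef_eq_one_of_ne_zero hβ] at h5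
      exact zero_ne_one (α := ZMod 2) ((congrArg coef (LinRep.ev η i).map_zero).symm.trans h5)
    have h3 : Rel x y := ⟨h2, h1⟩
    refine ⟨α h3, incl_hom_ext ?_⟩
    rw [coef_α_comp _ (last_add_one x), coef_eq_one_of_ne_zero hβ, coef_α]
  refine ⟨f, LinRep.hom_ext fun i (v : (incl n).obj (initial i) ⟶ _) => ?_⟩
  by_cases hv : v = 0
  · subst hv
    exact (map_zero _).trans (map_zero _).symm
  · obtain ⟨h, rfl⟩ := exists_eq_comp_α hv
    rw [hη h, toRep_ev, Category.assoc, hf]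

lemma exists_isBilimit_singles (X : IntervalMultiset n) :
    ∃ (J : Type) (_ : Fintype J) (p : J → IntervalOfType n)
      (b : Bicone fun j => (incl n).obj (p j)), b.pt = X ∧ Nonempty b.IsBilimit :=
  ⟨X.Index, inferInstance, _, X.singlesBicone, rfl, ⟨X.singlesBiconeIsBilimit⟩⟩

instance : (toRep n).Faithful :=
  (toRep n).faithful_of_isBilimit _ exists_isBilimit_singles toRep_map_incl_injective

instance : (toRep n).Full :=
  (toRep n).full_of_isBilimit _ exists_isBilimit_singles toRep_map_incl_surjective

end IntervalMultiset

namespace LinRep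

variable {n : ℕ}

lemma ev_injective {V W : LinRep n} (η : V ⟶ W) [Mono η] (i : Fin n) :
    Function.Injective (ev η i) := by
  have : Mono (η.app (Opposite.op i)) := inferInstance
  have h : Mono ((forget₂ (FGModuleCat (ZMod 2)) (ModuleCat (ZMod 2))).map
    (η.app (Opposite.op i))) := inferInstance
  exact (ModuleCat.mono_iff_injective _).1 h

lemma ev_surjective {V W : LinRep n} (η : V ⟶ W) [Epi η] (i : Fin n) :
    Function.Surjective (ev η i) := by
  have : Epi (η.app (Opposite.op i)) := inferInstance
  have h : Epi ((forget₂ (FGModuleCat (ZMod 2)) (ModuleCat (ZMod 2))).map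
    (η.app (Opposite.op i))) := inferInstance
  exact (ModuleCat.epi_iff_surjective _).1 h

/-- The total dimension of a representation. -/
noncomputable def dim (V : LinRep n) : ℕ := ∑ i, Module.finrank (ZMod 2) (V.space i)

lemma dim_le_of_mono {V W : LinRep n} (η : V ⟶ W) [Mono η] : V.dim ≤ W.dim :=
  Finset.sum_le_sum fun i _ => LinearMap.finrank_le_finrank_of_injective (ev_injective η i)

lemma dim_lt_of_epi {V W : LinRep n} (η : V ⟶ W) [Epi η] {i : Fin n} {v : V.space i}
    (hv : v ≠ 0) (h : ev η i v = 0) : W.dim < V.dim := by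
  have e (i : Fin n) := LinearMap.finrank_range_add_finrank_ker (ev η i)
  have e' (i : Fin n) : Module.finrank (ZMod 2) (ev η i).range =
      Module.finrank (ZMod 2) (W.space i) := by
    rw [LinearMap.range_eq_top.2 (ev_surjective η i), finrank_top]
  refine Finset.sum_lt_sum (fun i _ => ?_) ⟨i, Finset.mem_univ i, ?_⟩
  · rw [← e i, e']
    exact Nat.le_add_right _ _
  · rw [← e i, e']
    refine Nat.lt_add_of_pos_right (Module.finrank_pos_iff_exists_ne_zero.2 ⟨⟨v, h⟩, ?_⟩)
    exact fun h' => hv (congrArg Subtype.val h')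

lemma dim_pos_iff (V : LinRep n) : 0 < V.dim ↔ ∃ i, Nontrivial (V.space i) := by
  simp only [dim, Finset.sum_pos_iff, Finset.mem_univ, true_and, Module.finrank_pos_iff]

lemma isZero_of_dim_eq_zero {V : LinRep n} (h : V.dim = 0) : IsZero V := by
  refine (IsZero.iff_id_eq_zero _).2 (hom_ext fun i v => ?_)
  have : Subsingleton (V.space i) := by
    rw [← not_nontrivial_iff_subsingleton]
    exact fun h' => h.not_gt ((dim_pos_iff V).2 ⟨i, h'⟩)
  exact Subsingleton.elim _ _

end LinRep

namespace IntervalMultiset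

open IntervalOfType

variable {n : ℕ}

/-- The interval `[i + 1, j + 1]`. -/
def ofFin {i j : Fin n} (h : i ≤ j) : IntervalOfType n where
  a := i + 1
  b := j + 1
  one_le := by omega
  a_le_b := by simpa using h
  le_n := by omega

lemma rel_initial_ofFin_iff {i j k : Fin n} (h : i ≤ j) :
    Rel (initial k) (ofFin h) ↔ i ≤ k ∧ k ≤ j := by
  rw [rel_initial_iff, Fin.le_def, Fin.le_def]
  simp only [ofFin]
  omega

/-- The entry of one-by-one matrices as a linear map. -/
def coefₗ (x y : IntervalOfType n) : ((incl n).obj x ⟶ (incl n).obj y) →ₗ[ZMod 2] ZMod 2 where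
  toFun := coef
  map_add' _ _ := rfl
  map_smul' _ _ := rfl

/-- An element of a representation at `j` defines a morphism from the interval `[i + 1, j + 1]` if
the representation vanishes below `i`. -/
def fromInterval (V : LinRep n) {i j : Fin n} (h : i ≤ j)
    (hV : ∀ k < i, Subsingleton (V.space k)) (w : V.space j) :
    (toRep n).obj ((incl n).obj (ofFin h)) ⟶ V :=
  LinRep.homMk (fun k => (LinearMap.toSpanSingleton (ZMod 2) (V.space k)
      (if h' : k ≤ j then V.res h' w else 0)).comp (coefₗ (initial k) (ofFin h)))
    fun k l hkl (f : (incl n).obj (initial l) ⟶ _) => by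
      rcases lt_or_ge k i with hk | hk
      · have := hV k hk
        exact Subsingleton.elim _ _
      change coef (α (initial_rel_initial hkl) ≫ f) • _ = V.res hkl (coef f • _)
      rw [coef_comp, map_smul, coef_α, mul_one]
      by_cases hf : f = 0
      · subst hf
        have : coef (0 : (incl n).obj (initial l) ⟶ (incl n).obj (ofFin h)) = 0 := rfl
        rw [this, ite_self, zero_smul, zero_smul]
      · have hl := (rel_initial_ofFin_iff h).1 (not_imp_comm.1 (eq_zero_of_not_rel · f) hf)
        rw [dif_pos hl.2, dif_pos (hkl.trans hl.2), V.res_res, if_pos]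
        simpa [initial, ofFin] using hk

/-- A linear functional on a representation at `i` defines a morphism to the interval
`[i + 1, j + 1]` if it vanishes on what comes from beyond `j`. -/
def toInterval (V : LinRep n) {i j : Fin n} (h : i ≤ j) (ψ : V.space i →ₗ[ZMod 2] ZMod 2)
    (hψ : ∀ k (hk : i ≤ k), j < k → ∀ v, ψ (V.res hk v) = 0) :
    V ⟶ (toRep n).obj ((incl n).obj (ofFin h)) :=
  LinRep.homMk (fun k => (LinearMap.toSpanSingleton (ZMod 2)
      ((incl n).obj (initial k) ⟶ (incl n).obj (ofFin h))
      (if h' : Rel (initial k) (ofFin h) then α h' else 0)).comp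
        (ψ.comp (if h' : i ≤ k then V.res h' else 0)))
    fun k l hkl v => by
      by_cases hk : Rel (initial k) (ofFin h)
      · refine incl_hom_ext ?_
        have hk' := (rel_initial_ofFin_iff h).1 hk
        rw [dif_pos hk, dif_pos hk'.1, dif_pos (hk'.1.trans hkl)]
        change coef (ψ (V.res hk'.1 (V.res hkl v)) • α hk) =
          coef (α (initial_rel_initial hkl) ≫ (ψ (V.res (hk'.1.trans hkl) v) • _))
        rw [V.res_res]
        rcases lt_or_ge j l with hl | hl
        · rw [hψ l _ hl, zero_smul, zero_smul, comp_zero]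
        · rw [dif_pos ((rel_initial_ofFin_iff h).2 ⟨hk'.1.trans hkl, hl⟩), Linear.comp_smul]
          refine congrArg coef (congrArg _ (incl_hom_ext ?_))
          rw [coef_comp, if_pos hk.2.1]
          rfl
      · exact (eq_zero_of_not_rel hk _).trans (eq_zero_of_not_rel hk _).symm

/-- Every non-zero representation has an interval as a direct summand. -/
theorem exists_interval_retract (V : LinRep n) (hV : 0 < V.dim) :
    ∃ x : IntervalOfType n, Nonempty (Retract ((toRep n).obj ((incl n).obj x)) V) := by
  classical
  obtain ⟨i, hi, hmin⟩ := WellFounded.has_min (wellFounded_lt (α := Fin n))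
    {i | Nontrivial (V.space i)} (V.dim_pos_iff.1 hV)
  have hV' (k) (hk : k < i) : Subsingleton (V.space k) :=
    not_nontrivial_iff_subsingleton.1 fun h => hmin k h hk
  obtain ⟨j, ⟨hij, w, hw⟩, hmax⟩ := WellFounded.has_min (wellFounded_gt (α := Fin n))
    {j | ∃ (h : i ≤ j) (w : V.space j), V.res h w ≠ 0} (by
      obtain ⟨v, hv⟩ := @exists_ne _ hi (0 : V.space i)
      exact ⟨i, le_rfl, v, by rwa [V.res_refl]⟩)
  obtain ⟨ψ, hψ⟩ : ∃ ψ : V.space i →ₗ[ZMod 2] ZMod 2, ψ (V.res hij w) ≠ 0 := by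
    by_contra! h
    exact hw ((Module.forall_dual_apply_eq_zero_iff (ZMod 2) _).1 h)
  let s := fromInterval V hij hV' w
  let r := toInterval V hij ψ fun k hk hjk v => by
    by_contra h
    exact hmax k ⟨hk, v, fun h' => h (by rw [h', map_zero])⟩ hjk
  have hi' : Rel (initial i) (ofFin hij) := (rel_initial_ofFin_iff hij).2 ⟨le_rfl, hij⟩
  have hsr : s ≫ r ≠ 0 := by
    intro h
    have h1 := congrArg (fun η => coef (LinRep.ev η i (α hi') :
      (incl n).obj (initial i) ⟶ (incl n).obj (ofFin hij))) h
    have h2 : LinRep.ev s i (α hi') = V.res hij w := by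
      change coef (α hi') • (if h' : i ≤ j then V.res h' w else 0) = _
      rw [dif_pos hij, coef_α, one_smul]
    have h3 : LinRep.ev r i (V.res hij w) = α hi' := by
      change ψ ((if h' : i ≤ i then V.res h' else 0) (V.res hij w)) •
        (if h' : Rel (initial i) (ofFin hij) then α h' else 0) = _
      rw [dif_pos hi', dif_pos le_rfl, V.res_refl, zmod_two_eq_one hψ]
      exact one_smul _ _
    change coef (LinRep.ev r i (LinRep.ev s i (α hi'))) = 0 at h1
    rw [h2, h3] at h1
    exact one_ne_zero h1
  obtain ⟨e, he⟩ := (toRep n).map_surjective (s ≫ r)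
  refine ⟨ofFin hij, ⟨⟨s, r, ?_⟩⟩⟩
  have he0 : e ≠ 0 := by
    rintro rfl
    exact hsr (he ▸ Functor.map_zero _ _ _)
  rw [← he, eq_id_of_ne_zero he0, CategoryTheory.Functor.map_id]

theorem exists_toRep_iso (V : LinRep n) : ∃ X, Nonempty ((toRep n).obj X ≅ V) := by
  induction h : V.dim using Nat.strong_induction_on generalizing V with
  | _ m ih =>
    subst h
    rcases Nat.eq_zero_or_pos V.dim with h0 | h0
    · exact ⟨0, ⟨((toRep n).map_isZero isZero_zero).iso (LinRep.isZero_of_dim_eq_zero h0)⟩⟩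
    obtain ⟨x, ⟨r⟩⟩ := exists_interval_retract V h0
    have : IsSplitMono r.i := ⟨⟨r.r, r.retract⟩⟩
    have hlt : (cokernel r.i).dim < V.dim := by
      refine LinRep.dim_lt_of_epi (cokernel.π r.i) (i := last x)
        (v := LinRep.ev r.i (last x) (α (rel_initial_last x))) ?_ ?_
      · intro h
        refine α_ne_zero (rel_initial_last x) (LinRep.ev_injective r.i (last x) ?_)
        exact h.trans (map_zero _).symm
      · exact congrArg (fun η => LinRep.ev η (last x) (α (rel_initial_last x)))
          (cokernel.condition r.i)
    obtain ⟨Y, ⟨e⟩⟩ := ih _ hlt _ rfl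
    have := preservesBinaryBiproducts_of_preservesBiproducts (toRep n)
    exact ⟨(incl n).obj x ⊞ Y, ⟨(toRep n).mapBiprod _ _ ≪≫ biprod.mapIso (Iso.refl _) e ≪≫
      (biprod.uniqueUpToIso _ _ (isBilimitBinaryBiconeOfIsSplitMonoOfCokernel
        (cokernelIsCokernel r.i))).symm⟩⟩

instance : (toRep n).EssSurj := ⟨exists_toRep_iso⟩

instance : (toRep n).IsEquivalence where

noncomputable instance abelian (n : ℕ) : Abelian (IntervalMultiset n) :=
  abelianOfEquivalence (toRep n)

lemma abelian_toPreadditive (n : ℕ) : (abelian n).toPreadditive = preadditive n := by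
  with_reducible_and_instances rfl

/-- The total dimension of a multiset of intervals. -/
noncomputable def dim (X : IntervalMultiset n) : ℕ := ((toRep n).obj X).dim

lemma dim_eq_sum (X : IntervalMultiset n) :
    X.dim = ∑ i : Fin n, Module.finrank (ZMod 2) ((incl n).obj (initial i) ⟶ X) := rfl

lemma dim_le_of_mono {X Y : IntervalMultiset n} (f : X ⟶ Y) [Mono f] : X.dim ≤ Y.dim :=
  LinRep.dim_le_of_mono ((toRep n).map f)

lemma dim_eq_of_iso {X Y : IntervalMultiset n} (e : X ≅ Y) : X.dim = Y.dim :=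
  (dim_le_of_mono e.hom).antisymm (dim_le_of_mono e.inv)

lemma isZero_of_dim_eq_zero {X : IntervalMultiset n} (h : X.dim = 0) : IsZero X :=
  (IsZero.iff_id_eq_zero X).2 ((toRep n).map_injective
    ((LinRep.isZero_of_dim_eq_zero h).eq_of_src _ _))

lemma dim_eq_zero_of_isZero {X : IntervalMultiset n} (h : IsZero X) : X.dim = 0 := by
  rw [dim_eq_sum]
  refine Finset.sum_eq_zero fun i _ => ?_
  have : Subsingleton ((incl n).obj (initial i) ⟶ X) := ⟨h.eq_of_tgt⟩
  exact Module.finrank_zero_of_subsingleton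

/-- The total dimension is additive on short exact sequences. -/
lemma dim_eq_add_of_exact {X Y Z : IntervalMultiset n} (f : X ⟶ Y) (g : Y ⟶ Z) [Mono f] [Epi g]
    (w : f ≫ g = 0) (h : ∀ (W : IntervalMultiset n) (k : W ⟶ Y), k ≫ g = 0 → ∃ l, l ≫ f = k) :
    Y.dim = X.dim + Z.dim := by
  simp only [dim, LinRep.dim, ← Finset.sum_add_distrib]
  refine Finset.sum_congr rfl fun i _ => ?_
  have hr : (LinRep.ev ((toRep n).map f) i).range = (LinRep.ev ((toRep n).map g) i).ker := by
    ext k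
    constructor
    · rintro ⟨l, rfl⟩
      refine (Category.assoc l f g).trans ?_
      rw [w]
      exact comp_zero
    · intro hk
      exact h _ k hk
  rw [← LinearMap.finrank_range_add_finrank_ker (LinRep.ev ((toRep n).map g) i), ← hr,
    LinearMap.finrank_range_of_inj (LinRep.ev_injective ((toRep n).map f) i),
    LinearMap.range_eq_top.2 (LinRep.ev_surjective ((toRep n).map g) i), finrank_top, add_comm]

lemma dim_eq_add_of_cokernel {X Y Z : IntervalMultiset n} (f : X ⟶ Y) (g : Y ⟶ Z) [Mono f]
    (w : f ≫ g = 0) (h : IsColimit (CokernelCofork.ofπ g w)) : Y.dim = X.dim + Z.dim := by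
  have : Epi g := epi_of_isColimit_cofork h
  have hk := Abelian.monoIsKernelOfCokernel _ h
  exact dim_eq_add_of_exact f g w fun W k hk' =>
    ⟨hk.lift (KernelFork.ofι k hk'), hk.fac _ WalkingParallelPair.zero⟩

lemma dim_eq_add_of_epi {X Y : IntervalMultiset n} (g : X ⟶ Y) [Epi g] :
    X.dim = (kernel g).dim + Y.dim :=
  dim_eq_add_of_exact (kernel.ι g) g (kernel.condition g) fun _ k hk =>
    ⟨kernel.lift g k hk, kernel.lift_ι g k hk⟩

lemma finrank_hom (x y : IntervalOfType n) :
    Module.finrank (ZMod 2) ((incl n).obj x ⟶ (incl n).obj y) = if Rel x y then 1 else 0 := by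
  split_ifs with h
  · refine finrank_eq_one (α h) (α_ne_zero h) fun f => ⟨coef f, incl_hom_ext ?_⟩
    exact mul_one (coef f)
  · have : Subsingleton ((incl n).obj x ⟶ (incl n).obj y) :=
      ⟨fun f g => (eq_zero_of_not_rel h f).trans (eq_zero_of_not_rel h g).symm⟩
    exact Module.finrank_zero_of_subsingleton

lemma dim_incl {x : IntervalOfType n} {l : ℕ} (h : x.HasLength l) :
    ((incl n).obj x).dim = l + 1 := by
  calc ((incl n).obj x).dim = ∑ i : Fin n, if Rel (initial i) x then 1 else 0 := by
        simp only [dim_eq_sum, finrank_hom]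
    _ = ∑ i ∈ Finset.range n, if x.a ≤ i + 1 ∧ (i : ℤ) + 1 ≤ x.b then 1 else 0 := by
        rw [← Fin.sum_univ_eq_sum_range
          (fun i => if x.a ≤ (i : ℤ) + 1 ∧ (i : ℤ) + 1 ≤ x.b then 1 else 0)]
        simp only [rel_initial_iff]
    _ = (Finset.Ico (x.a - 1).toNat x.b.toNat).card := by
        rw [Finset.sum_boole, Nat.cast_id]
        congr 1
        ext i
        have := x.one_le; have := x.le_n
        simp only [Finset.mem_filter, Finset.mem_range, Finset.mem_Ico]
        omega
    _ = l + 1 := by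
        have := x.one_le; have := x.a_le_b
        unfold HasLength at h
        rw [Nat.card_Ico]
        omega

lemma simple_of_dim_eq_one {S : IntervalMultiset n} (h : S.dim = 1) : Simple S where
  mono_isIso_iff_nonzero {Y} f _ := by
    have e := dim_eq_add_of_cokernel f _ (cokernel.condition f) (cokernelIsCokernel f)
    constructor
    · rintro _ rfl
      have : IsZero S := by
        rw [IsZero.iff_id_eq_zero, ← IsIso.inv_hom_id (0 : Y ⟶ S), comp_zero]
      exact zero_ne_one ((dim_eq_zero_of_isZero this).symm.trans h)
    · intro hf
      have hY : Y.dim ≠ 0 := fun h' => hf ((isZero_of_dim_eq_zero h').eq_of_src _ _)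
      have : Epi f := Preadditive.epi_of_isZero_cokernel f (isZero_of_dim_eq_zero (by omega))
      exact isIso_of_mono_of_epi f

/-- The interval `[a, a]`. -/
def point (a : ℤ) (h : 1 ≤ a) (h' : a ≤ n) : IntervalOfType n := ⟨a, a, h, le_rfl, h'⟩

lemma dim_point (a : ℤ) (h : 1 ≤ a) (h' : a ≤ n) : ((incl n).obj (point a h h')).dim = 1 :=
  dim_incl (l := 0) (sub_self a)

lemma simple_point (a : ℤ) (h : 1 ≤ a) (h' : a ≤ n) : Simple ((incl n).obj (point a h h')) :=
  simple_of_dim_eq_one (dim_point a h h')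

lemma ne_zero_of_not_isZero {X : IntervalMultiset n} (h : ¬ IsZero X) : X ≠ 0 :=
  mt (isZero_iff X).2 h

lemma dim_eq_one_of_simple {S : IntervalMultiset n} [Simple S] : S.dim = 1 := by
  obtain ⟨x, ⟨r⟩⟩ := exists_retract (ne_zero_of_not_isZero (Simple.not_isZero S))
  have hx := x.a_le_b.trans x.le_n
  have := simple_point x.a x.one_le hx
  have hrel : Rel (point x.a x.one_le hx) x := ⟨le_rfl, le_rfl, x.a_le_b⟩
  have hne : α hrel ≫ r.i ≠ 0 := by
    intro h
    refine α_ne_zero hrel ?_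
    rw [← Category.comp_id (α hrel), ← r.retract, reassoc_of% h, zero_comp]
  have := isIso_of_hom_simple hne
  rw [← dim_eq_of_iso (asIso (α hrel ≫ r.i)), dim_point]

/-- Every object of positive dimension has a subobject with quotient of dimension one. -/
lemma exists_mono_dim {X : IntervalMultiset n} (h : 0 < X.dim) :
    ∃ (Y : IntervalMultiset n) (f : Y ⟶ X), Mono f ∧ Y.dim + 1 = X.dim := by
  have h0 : ¬ IsZero X := fun h0 => h.ne' (dim_eq_zero_of_isZero h0)
  obtain ⟨x, ⟨r⟩⟩ := exists_retract (ne_zero_of_not_isZero h0)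
  have hx := x.one_le.trans x.a_le_b
  have := simple_point x.b hx x.le_n
  have hrel : Rel x (point x.b hx x.le_n) := ⟨x.a_le_b, le_rfl, le_rfl⟩
  have hne : r.r ≫ α hrel ≠ 0 := by
    intro h
    refine α_ne_zero hrel ?_
    rw [← Category.id_comp (α hrel), ← r.retract, Category.assoc, h, comp_zero]
  have := epi_of_nonzero_to_simple hne
  refine ⟨_, kernel.ι (r.r ≫ α hrel), inferInstance, ?_⟩
  rw [dim_eq_add_of_epi (r.r ≫ α hrel), dim_point]

lemma dim_top (X : IntervalMultiset n) : ((⊤ : Subobject X) : IntervalMultiset n).dim = X.dim := by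
  rw [Subobject.top_eq_id]
  exact dim_eq_of_iso (Subobject.underlyingIso (𝟙 X))

lemma exists_subobject_le {X : IntervalMultiset n} (A : Subobject X) :
    ∃ B ≤ A, (B : IntervalMultiset n).dim = (A : IntervalMultiset n).dim - 1 := by
  rcases Nat.eq_zero_or_pos (A : IntervalMultiset n).dim with h | h
  · exact ⟨A, le_rfl, by omega⟩
  obtain ⟨Y, f, _, hY⟩ := exists_mono_dim h
  refine ⟨Subobject.mk (f ≫ A.arrow), Subobject.mk_le_of_comm f rfl, ?_⟩
  rw [dim_eq_of_iso (Subobject.underlyingIso (f ≫ A.arrow))]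
  omega

theorem nonempty_compositionSeries (X : IntervalMultiset n) :
    Nonempty (ObjectCompositionSeries X X.dim) := by
  choose p hp hp' using exists_subobject_le (X := X)
  have hd (k : ℕ) : ((p^[k] ⊤ : Subobject X) : IntervalMultiset n).dim = X.dim - k := by
    induction k with
    | zero => exact dim_top X
    | succ k ih => rw [Function.iterate_succ_apply', hp', ih]; omega
  have hle (i : Fin X.dim) : p^[X.dim - (i.castSucc : ℕ)] ⊤ ≤ p^[X.dim - (i.succ : ℕ)] ⊤ := by
    have : X.dim - (i.castSucc : ℕ) = X.dim - (i.succ : ℕ) + 1 := by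
      simp only [Fin.val_castSucc, Fin.val_succ]; omega
    rw [this, Function.iterate_succ_apply']
    exact hp _
  exact ⟨{
    sub := fun i => p^[X.dim - (i : ℕ)] ⊤
    isZero_first := isZero_of_dim_eq_zero (by rw [hd]; simp)
    last_eq_top := by simp
    le := hle
    factor := fun i => cokernel (Subobject.ofLE _ _ (hle i))
    proj := fun i => cokernel.π _
    comp_proj := fun i => cokernel.condition _
    isCokernel := fun i => ⟨cokernelIsCokernel _⟩
    simple := fun i => simple_of_dim_eq_one (by
      have := dim_eq_add_of_cokernel _ _ (cokernel.condition (Subobject.ofLE _ _ (hle i)))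
        (cokernelIsCokernel _)
      rw [hd, hd] at this
      have h1 := i.val_castSucc
      have h2 := i.val_succ
      omega) }⟩

theorem length_compositionSeries {X : IntervalMultiset n} {m : ℕ}
    (s : ObjectCompositionSeries X m) : m = X.dim := by
  have h (i : Fin (m + 1)) : (s.sub i : IntervalMultiset n).dim = i := by
    induction i using Fin.induction with
    | zero => exact dim_eq_zero_of_isZero s.isZero_first
    | succ i ih =>
      have := s.simple i
      rw [dim_eq_add_of_cokernel _ _ (s.comp_proj i) (s.isCokernel i).some, ih,
        dim_eq_one_of_simple]
      simp
  have hl := h (Fin.last m)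
  rw [s.last_eq_top, dim_top X] at hl
  exact hl.symm

theorem nonempty_compositionSeries_iff (X : IntervalMultiset n) (m : ℕ) :
    Nonempty (ObjectCompositionSeries X m) ↔ m = X.dim :=
  ⟨fun ⟨s⟩ => length_compositionSeries s, fun h => h ▸ nonempty_compositionSeries X⟩

end IntervalMultiset

theorem mainTheorem6 (n : ℕ) (hn : 1 ≤ n) :
    -- `A_n`, with its given additive structure, is abelian
    (∃ h : Abelian (IntervalMultiset n),
      h.toPreadditive = IntervalMultiset.preadditive n) ∧
    -- direct sums are given by disjoint unions
    (∀ (ι : Type) [Fintype ι] (X : ι → IntervalMultiset n),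
      ∃ B : Bicone X, B.pt = ∑ i, X i ∧ Nonempty B.IsBilimit) ∧
    -- the inclusion identifies `I_n` with the full subcategory of indecomposable objects
    (∃ _ : HasBinaryBiproducts (IntervalMultiset n), ∀ X : IntervalMultiset n,
      Indecomposable X ↔ ∃ x : IntervalOfType n, X = (IntervalMultiset.incl n).obj x) ∧
    Function.Injective (IntervalMultiset.incl n).obj ∧
    (IntervalMultiset.incl n).Full ∧
    (IntervalMultiset.incl n).Faithful ∧
    (IntervalMultiset.incl n).Additive ∧
    (IntervalMultiset.incl n).Linear (ZMod 2) ∧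
    -- every object has a finite composition series
    (∀ X : IntervalMultiset n, ∃ m : ℕ, Nonempty (ObjectCompositionSeries X m)) ∧
    -- an interval of length `l` has composition length `l + 1`
    (∀ (x : IntervalOfType n) (l : ℕ), x.HasLength l → ∀ m : ℕ,
      Nonempty (ObjectCompositionSeries ((IntervalMultiset.incl n).obj x) m) ↔ m = l + 1) :=
  ⟨⟨IntervalMultiset.abelian n, IntervalMultiset.abelian_toPreadditive n⟩,
    fun _ _ X => IntervalMultiset.exists_isBilimit_sum X,
    ⟨inferInstance, IntervalMultiset.indecomposable_iff⟩,
    IntervalMultiset.incl_obj_injective, inferInstance, inferInstance, inferInstance,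
    inferInstance, fun X => ⟨_, IntervalMultiset.nonempty_compositionSeries X⟩,
    fun x l h m => by
      rw [IntervalMultiset.nonempty_compositionSeries_iff, IntervalMultiset.dim_incl h]⟩
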